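/- Let $X$ be a complex Hilbert space with inner product $(\cdot,\cdot)$ (linear in the first argument). Let $J$ be a (possibly unbounded) skew-symmetric operator on $X$, $(Ju,v)=-(u,Jv)$ for $u,v\in D(J)$, with bounded everywhere defined inverse $J^{-1}:X\to D(J)$. Let $\mathcal I\subset\mathbb R$ be an interval, and for each $s\in\mathcal I$ let $L(s)$ be a (possibly unbounded) symmetric operator on $X$, $(L(s)u,v)=(u,L(s)v)$ for $u,v\in D(L(s))$. Put $T(s)=JL(s)$, with domain $\{u\in D(L(s)) : L(s)u\in D(J)\}$. Assume that $T(s)$, $s\in\mathcal I$, is a resolvent-continuous family of closed operators: for each $s_*\in\mathcal I$ there is $\xi\in\mathbb C$ such that $s\mapsto(\xi-T(s))^{-1}$ is defined (as a bounded operator on $X$) and norm-continuous for $s$ in a neighborhood of $s_*$ in $\mathcal I$. A discrete eigenvalue of $T(s)$ is an eigenvalue that is an isolated point of the spectrum and has finite algebraic multiplicity, i.e. whose Riesz spectral projection has finite rank. Let $\mathcal I'\subset\mathcal I$ be an interval over which a finite system $\Sigma(s)$ of discrete eigenvalues of $T(s)$ is continued (for example the maximal such interval). This means: for each $s\in\mathcal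 I'$, $\Sigma(s)$ is a finite set of discrete eigenvalues of $T(s)$, and there are bounded operators $P(s)$, $s\in\mathcal I'$, such that for each $s_1\in\mathcal I'$ there is a contour $\Gamma$ (a collection of small disjoint circles of a common radius centered at the points of $\Sigma(s_1)$) that contains $\Sigma(s_1)$ inside, has no other point of the spectrum of $T(s_1)$ on it or inside it, and satisfies, for all $s\in\mathcal I'$ close to $s_1$, that $\Gamma$ lies in the resolvent set of $T(s)$ and $$P(s)=\frac1{2\pi i}\int_\Gamma(\xi-T(s))^{-1}\,d\xi .$$ Let $X_1(s)$, the generalized eigenspace associated with $\Sigma(s)$, be the range of the spectral projection $P(s)$. Let $s_0\in\mathcal I'$. If the real quadratic form $u\mapsto(iJ^{-1}u,u)$ is positive definite on $X_1(s_0)$, then it is positive definite on $X_1(s)$ for all $s\in\mathcal I'$; if it is negative definite on $X_1(s_0)$, then it is negative definite on $X_1(s)$ for all $s\in\mathcal I'$. In either case, all eigenvalues in $\Sigma(s)$ are purely imaginary (have zero real part) for all $s\in\mathcal I'$. -/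

import Mathlib

open scoped Topology

noncomputable section

namespace KreinCont

variable {X : Type*} [NormedAddCommGroup X] [InnerProductSpace ℂ X]

/-- `R` is the bounded, everywhere defined, two-sided inverse of the (possibly unbounded)
operator `A`: it maps `X` into the domain of `A`, `A (R f) = f` for all `f` in `X`, and
`R (A u) = u` for all `u` in the domain of `A`. -/
def IsBoundedInverse (A : X →ₗ.[ℂ] X) (R : X →L[ℂ] X) : Prop :=
  (∀ f : X, ∃ h : R f ∈ A.domain, A ⟨R f, h⟩ = f) ∧ ∀ u : A.domain, R (A u) = u

/-- Symmetry of a possibly unbounded operator, `(A u, v) = (u, A v)` on the domain.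
Density of the domain is not required. -/
def IsSymmetricOp (A : X →ₗ.[ℂ] X) : Prop :=
  ∀ u v : A.domain, inner ℂ (A u) (v : X) = inner ℂ (u : X) (A v)

/-- Skew-symmetry of a possibly unbounded operator, `(A u, v) = -(u, A v)` on the domain. -/
def IsSkewSymmetricOp (A : X →ₗ.[ℂ] X) : Prop :=
  ∀ u v : A.domain, inner ℂ (A u) (v : X) = -inner ℂ (u : X) (A v)

/-- The product `A B` of two possibly unbounded operators, on its natural domain
`{u ∈ D(B) : B u ∈ D(A)}`. -/
def mulOp (A B : X →ₗ.[ℂ] X) : X →ₗ.[ℂ] X where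
  domain :=
    { carrier := {u | ∃ h : u ∈ B.domain, B ⟨u, h⟩ ∈ A.domain}
      zero_mem' := ⟨B.domain.zero_mem, by
        have h0 : B ⟨0, B.domain.zero_mem⟩ = 0 := B.map_zero
        rw [h0]
        exact A.domain.zero_mem⟩
      add_mem' := by
        rintro u v ⟨hu, hu'⟩ ⟨hv, hv'⟩
        refine ⟨B.domain.add_mem hu hv, ?_⟩
        have h1 : B ⟨u + v, B.domain.add_mem hu hv⟩ = B ⟨u, hu⟩ + B ⟨v, hv⟩ :=
          B.map_add ⟨u, hu⟩ ⟨v, hv⟩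
        rw [h1]
        exact A.domain.add_mem hu' hv'
      smul_mem' := by
        rintro c u ⟨hu, hu'⟩
        refine ⟨B.domain.smul_mem c hu, ?_⟩
        have h1 : B ⟨c • u, B.domain.smul_mem c hu⟩ = c • B ⟨u, hu⟩ := B.map_smul c ⟨u, hu⟩
        rw [h1]
        exact A.domain.smul_mem c hu' }
  toFun :=
    { toFun := fun u => A ⟨B ⟨u, u.2.choose⟩, u.2.choose_spec⟩
      map_add' := by
        intro u v
        rw [← A.map_add]
        congr 1
        apply Subtype.ext
        exact B.map_add ⟨u, u.2.choose⟩ ⟨v, v.2.choose⟩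
      map_smul' := by
        intro c u
        rw [RingHom.id_apply, ← A.map_smul]
        congr 1
        apply Subtype.ext
        exact B.map_smul c ⟨u, u.2.choose⟩ }

/-- The operator `ξ - T`, with the domain of `T`. -/
def shiftOp (T : X →ₗ.[ℂ] X) (ξ : ℂ) : X →ₗ.[ℂ] X where
  domain := T.domain
  toFun := ξ • T.domain.subtype - T.toFun

/-- The resolvent set of `T`: those `ξ` for which `ξ - T` has a bounded inverse. -/
def resolventSetOp (T : X →ₗ.[ℂ] X) : Set ℂ :=
  {ξ | ∃ R : X →L[ℂ] X, IsBoundedInverse (shiftOp T ξ) R}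

/-- The spectrum of `T`. -/
def spectrumOp (T : X →ₗ.[ℂ] X) : Set ℂ := (resolventSetOp T)ᶜ

open Classical in
/-- The resolvent `(ξ - T)⁻¹` (a bounded inverse is unique), set to `0` for `ξ` in the spectrum. -/
def resolventOp (T : X →ₗ.[ℂ] X) (ξ : ℂ) : X →L[ℂ] X :=
  if h : ξ ∈ resolventSetOp T then h.choose else 0

/-- A family of closed operators `T s`, `s ∈ I`, is resolvent-continuous on `I` if for each
`s₀ ∈ I` there is `ξ ∈ ℂ` such that `s ↦ (ξ - T s)⁻¹` is defined and continuous in operator norm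
for `s` in a neighbourhood of `s₀` in `I`. -/
def ResolventContinuousOn (T : ℝ → X →ₗ.[ℂ] X) (I : Set ℝ) : Prop :=
  (∀ s ∈ I, (T s).IsClosed) ∧
    ∀ s₀ ∈ I, ∃ ξ : ℂ, ∃ U ∈ 𝓝 s₀,
      (∀ s ∈ U ∩ I, ξ ∈ resolventSetOp (T s)) ∧
        ContinuousOn (fun s => resolventOp (T s) ξ) (U ∩ I)

/-- The Riesz integral `(2πi)⁻¹ ∮ (ξ - T)⁻¹ dξ` over the circle with centre `z` and radius `r`. -/
def rieszIntegral (T : X →ₗ.[ℂ] X) (z : ℂ) (r : ℝ) : X →L[ℂ] X :=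
  (2 * Real.pi * Complex.I : ℂ)⁻¹ • ∮ ξ in C(z, r), resolventOp T ξ

/-- `z` is an eigenvalue of `T`. -/
def IsEigenvalueOp (T : X →ₗ.[ℂ] X) (z : ℂ) : Prop :=
  ∃ u : T.domain, (u : X) ≠ 0 ∧ T u = z • (u : X)

/-- `z` is a discrete eigenvalue of `T`: an eigenvalue that is an isolated point of the spectrum
and has finite (algebraic) multiplicity, i.e. whose Riesz projection has finite rank. -/
def IsDiscreteEigenvalue (T : X →ₗ.[ℂ] X) (z : ℂ) : Prop :=
  IsEigenvalueOp T z ∧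
    ∃ r > 0, Metric.closedBall z r ∩ spectrumOp T = {z} ∧
      FiniteDimensional ℂ (LinearMap.range (rieszIntegral T z r).toLinearMap)

/-- `Sig s`, `s ∈ I'`, is a finite system of discrete eigenvalues of the family `T s` continued
over `I'`, with spectral projections `P s`.

For each `s₁ ∈ I'`, `Sig s₁` is a finite set of discrete eigenvalues of `T s₁`, and there is a
contour `Γ`, consisting of small disjoint circles around the points of `Sig s₁`, that contains
`Sig s₁` and no other point of the spectrum of `T s₁` inside, such that, for all `s ∈ I'` near
`s₁`, the spectral projection `(2πi)⁻¹ ∮_Γ (ξ - T s)⁻¹ dξ` with this fixed contour is well defined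
and equal to `P s`. -/
structure IsFiniteEigenvalueSystem (T : ℝ → X →ₗ.[ℂ] X) (I' : Set ℝ) (Sig : ℝ → Finset ℂ)
    (P : ℝ → X →L[ℂ] X) : Prop where
  discrete : ∀ s ∈ I', ∀ z ∈ Sig s, IsDiscreteEigenvalue (T s) z
  contour : ∀ s₁ ∈ I', ∃ ε > 0,
    (∀ z ∈ Sig s₁, ∀ w ∈ Sig s₁, z ≠ w →
      Disjoint (Metric.closedBall z ε) (Metric.closedBall w ε)) ∧
    (∀ z ∈ Sig s₁, Metric.closedBall z ε ∩ spectrumOp (T s₁) = {z}) ∧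
    ∀ᶠ s in 𝓝[I'] s₁,
      (∀ z ∈ Sig s₁, Metric.sphere z ε ⊆ resolventSetOp (T s)) ∧
        P s = ∑ z ∈ Sig s₁, rieszIntegral (T s) z ε

/-- The spectral subspace (generalized eigenspace) `X₁`: the range of the spectral projection. -/
def spectralSubspace (P : X →L[ℂ] X) : Submodule ℂ X := LinearMap.range P.toLinearMap

/-- The quadratic form `(i K u, u)`; it is real when `K` is the inverse of a skew-symmetric
operator. (Mathlib's inner product is linear in its second argument.) -/
def kreinForm (K : X →L[ℂ] X) (u : X) : ℝ := (inner ℂ u (Complex.I • K u)).re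

/-- `(i K u, u)` is positive definite on `V`. -/
def PosDefOn (K : X →L[ℂ] X) (V : Submodule ℂ X) : Prop := ∀ u ∈ V, u ≠ 0 → 0 < kreinForm K u

/-- `(i K u, u)` is negative definite on `V`. -/
def NegDefOn (K : X →L[ℂ] X) (V : Submodule ℂ X) : Prop := ∀ u ∈ V, u ≠ 0 → kreinForm K u < 0

end KreinCont

end

/-! Write K for the inverse of J. On the domain of T(s) one has K T(s) = L(s), so T(s) is skew for
the Hermitian form [u, v] = (iKu, v), which is nondegenerate because K is injective. The set of s in
I' at which [·,·] is positive definite on X₁(s) is nonempty, open and closed in the connected set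
I'.

Open: P is norm continuous and of finite rank, so compactness of the unit sphere of X₁(s) gives a
lower bound on the form that survives small perturbations (`PosDefOn.eventually`).

Closed: a limit of definite forms is a priori only semidefinite. However, definiteness forces Σ(s)
onto the imaginary axis (`IsFiniteEigenvalueSystem.re_eq_zero`). The contour is then invariant under
ξ ↦ -conj ξ, and P(s) is self-adjoint for [·,·] (`inner_rieszIntegral_left`). This identity and
semidefiniteness both pass to limits, and together they restore definiteness: by Cauchy–Schwarz a
null vector v of X₁ is [·,·]-orthogonal to X₁, hence by self-adjointness of P to all of X, so Kv = 0
and v = 0 (`posDefOn_of_nonneg`).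

The negative case is the positive one for -K. -/

namespace KreinCont

variable {X : Type*} [NormedAddCommGroup X] [InnerProductSpace ℂ X]

/-! ### Resolvents of unbounded operators. -/

section Resolvent

variable {T : X →ₗ.[ℂ] X} {ξ η : ℂ}

theorem isBoundedInverse_resolventOp (h : ξ ∈ resolventSetOp T) :
    IsBoundedInverse (shiftOp T ξ) (resolventOp T ξ) := by
  rw [resolventOp, dif_pos h]
  exact Exists.choose_spec h

theorem IsBoundedInverse.unique {A : X →ₗ.[ℂ] X} {R S : X →L[ℂ] X}
    (hR : IsBoundedInverse A R) (hS : IsBoundedInverse A S) : R = S := by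
  ext f
  obtain ⟨h, e⟩ := hS.1 f
  have := hR.2 ⟨S f, h⟩
  rwa [e] at this

theorem resolventOp_eq {R : X →L[ℂ] X} (h : IsBoundedInverse (shiftOp T ξ) R) :
    resolventOp T ξ = R :=
  (isBoundedInverse_resolventOp ⟨R, h⟩).unique h

theorem resolventOp_mem (h : ξ ∈ resolventSetOp T) (f : X) : resolventOp T ξ f ∈ T.domain :=
  ((isBoundedInverse_resolventOp h).1 f).1

theorem apply_resolventOp (h : ξ ∈ resolventSetOp T) (f : X) :
    T ⟨resolventOp T ξ f, resolventOp_mem h f⟩ = ξ • resolventOp T ξ f - f := by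
  obtain ⟨h', e⟩ := (isBoundedInverse_resolventOp h).1 f
  have e' : ξ • resolventOp T ξ f - T ⟨resolventOp T ξ f, resolventOp_mem h f⟩ = f := e
  exact eq_sub_of_add_eq' (sub_eq_iff_eq_add.1 e').symm

theorem resolventOp_shift (h : ξ ∈ resolventSetOp T) (u : T.domain) :
    resolventOp T ξ (ξ • (u : X) - T u) = u :=
  (isBoundedInverse_resolventOp h).2 u

/-- The first resolvent identity. -/
theorem resolventOp_sub (hξ : ξ ∈ resolventSetOp T) (hη : η ∈ resolventSetOp T) :
    resolventOp T ξ - resolventOp T η = (η - ξ) • (resolventOp T ξ * resolventOp T η) := by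
  ext f
  have h := resolventOp_shift hξ ⟨resolventOp T η f, resolventOp_mem hη f⟩
  rw [apply_resolventOp hη] at h
  simp only [map_sub, map_smul] at h
  simp only [sub_apply, smul_apply, mul_apply_eq_comp]
  linear_combination (norm := module) h

theorem resolventOp_mul (hξ : ξ ∈ resolventSetOp T) (hη : η ∈ resolventSetOp T) (hne : ξ ≠ η) :
    resolventOp T ξ * resolventOp T η =
      (η - ξ)⁻¹ • resolventOp T ξ - (η - ξ)⁻¹ • resolventOp T η := by
  rw [← smul_sub, resolventOp_sub hξ hη, inv_smul_smul₀ (sub_ne_zero.2 hne.symm)]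

/-- The inverse is 1 - (ξ - η) R(ξ), by the resolvent identity used in both orders. -/
theorem isUnit_one_add_smul_resolventOp (hξ : ξ ∈ resolventSetOp T)
    (hη : η ∈ resolventSetOp T) : IsUnit (1 + (ξ - η) • resolventOp T η) := by
  have h1 := resolventOp_sub hξ hη
  have h2 := resolventOp_sub hη hξ
  refine ⟨⟨1 + (ξ - η) • resolventOp T η, 1 - (ξ - η) • resolventOp T ξ, ?_, ?_⟩, rfl⟩
  · simp only [mul_sub, add_mul, one_mul, mul_one, smul_mul_smul_comm]
    linear_combination (norm := module) (ξ - η) • h2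
  · simp only [sub_mul, mul_add, one_mul, mul_one, smul_mul_smul_comm]
    linear_combination (norm := module) (η - ξ) • h1

/-- On the domain, ξ - T = (1 + (ξ - η) R(η)) (η - T). This makes the resolvent set open and
expresses every resolvent through the one at η. -/
theorem isBoundedInverse_of_isUnit (hη : η ∈ resolventSetOp T)
    (hu : IsUnit (1 + (ξ - η) • resolventOp T η)) :
    IsBoundedInverse (shiftOp T ξ)
      (resolventOp T η * Ring.inverse (1 + (ξ - η) • resolventOp T η)) := by
  set B := 1 + (ξ - η) • resolventOp T η with hB
  have key : ∀ g, ξ • resolventOp T η g - T ⟨resolventOp T η g, resolventOp_mem hη g⟩ = B g := by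
    intro g
    rw [apply_resolventOp hη]
    simp only [hB, add_apply, smul_apply, one_apply_eq_self]
    module
  refine ⟨fun f => ⟨resolventOp_mem hη _, ?_⟩, fun u => ?_⟩
  · refine (key (Ring.inverse B f)).trans ?_
    rw [← mul_apply_eq_comp, Ring.mul_inverse_cancel _ hu,
      one_apply_eq_self]
  · have h := resolventOp_shift hη u
    set g := η • (u : X) - T u
    have hu' : u = ⟨resolventOp T η g, resolventOp_mem hη g⟩ := Subtype.ext h.symm
    rw [show shiftOp T ξ u = B g by rw [hu']; exact key g, mul_apply_eq_comp,
      ← mul_apply_eq_comp (Ring.inverse B), Ring.inverse_mul_cancel _ hu,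
      one_apply_eq_self, h]

/-- The resolvent at `ξ` in terms of the resolvent at `η`. -/
theorem resolventOp_eq_mul_inverse (hξ : ξ ∈ resolventSetOp T) (hη : η ∈ resolventSetOp T) :
    resolventOp T ξ = resolventOp T η * Ring.inverse (1 + (ξ - η) • resolventOp T η) :=
  resolventOp_eq (isBoundedInverse_of_isUnit hη (isUnit_one_add_smul_resolventOp hξ hη))

theorem differentiableAt_resolventOp [CompleteSpace X] (hη : η ∈ resolventSetOp T) :
    DifferentiableAt ℂ (resolventOp T) η := by
  have hc : Continuous fun ξ : ℂ => 1 + (ξ - η) • resolventOp T η := by fun_prop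
  have hd : DifferentiableAt ℂ (fun ξ : ℂ => 1 + (ξ - η) • resolventOp T η) η := by fun_prop
  have hu : IsUnit (1 + (η - η) • resolventOp T η) := by simp
  have he : resolventOp T =ᶠ[𝓝 η] fun ξ =>
      resolventOp T η * Ring.inverse (1 + (ξ - η) • resolventOp T η) := by
    have := hc.continuousAt.eventually_mem (Units.isOpen.mem_nhds hu)
    filter_upwards [this] with ξ h
    exact resolventOp_eq (isBoundedInverse_of_isUnit hη h)
  refine DifferentiableAt.congr_of_eventuallyEq ?_ he
  exact (differentiableAt_const _).mul
    ((differentiableAt_inverse (𝕜 := ℂ) hu).fun_comp' η hd)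

theorem continuousOn_resolventOp [CompleteSpace X] : ContinuousOn (resolventOp T) (resolventSetOp T) :=
  fun _ h => (differentiableAt_resolventOp h).continuousAt.continuousWithinAt

theorem resolventOp_eigenvector (h : ξ ∈ resolventSetOp T) {z : ℂ} (hz : ξ ≠ z) {u : T.domain}
    (hu : T u = z • (u : X)) : resolventOp T ξ u = (ξ - z)⁻¹ • (u : X) := by
  have := resolventOp_shift h u
  rw [hu, ← sub_smul, map_smul] at this
  rw [eq_inv_smul_iff₀ (sub_ne_zero.2 hz), this]

end Resolvent

end KreinCont

namespace KreinCont

open Complex Metric MeasureTheory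

/-! ### Circle integrals of vector-valued functions. -/

section CircleIntegral

variable {E F : Type*} [NormedAddCommGroup E] [NormedSpace ℂ E]
  [NormedAddCommGroup F] [NormedSpace ℂ F]

theorem circleIntegral_clm_comp [CompleteSpace E] [CompleteSpace F] (A : E →L[ℂ] F)
    {f : ℂ → E} {z : ℂ} {r : ℝ}
    (hf : CircleIntegrable f z r) : (∮ ξ in C(z, r), A (f ξ)) = A (∮ ξ in C(z, r), f ξ) := by
  simp only [circleIntegral, ← map_smul]
  exact A.intervalIntegral_comp_comm hf.out

/-- Fubini's theorem for continuous functions on a product of two circles. -/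
theorem circleIntegral_swap {f : ℂ → ℂ → E} {z w : ℂ} {r ρ : ℝ} (hr : 0 ≤ r) (hρ : 0 ≤ ρ)
    (hf : ContinuousOn f.uncurry (sphere z r ×ˢ sphere w ρ)) :
    (∮ ξ in C(z, r), ∮ η in C(w, ρ), f ξ η) = ∮ η in C(w, ρ), ∮ ξ in C(z, r), f ξ η := by
  have hc : Continuous fun p : ℝ × ℝ => f (circleMap z r p.1) (circleMap w ρ p.2) :=
    hf.comp_continuous (f := fun p : ℝ × ℝ => (circleMap z r p.1, circleMap w ρ p.2))
      (by fun_prop) fun p => ⟨circleMap_mem_sphere z hr p.1, circleMap_mem_sphere w hρ p.2⟩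
  have hF : Continuous (Function.uncurry fun θ φ : ℝ =>
      deriv (circleMap z r) θ • deriv (circleMap w ρ) φ •
        f (circleMap z r θ) (circleMap w ρ φ)) := by
    simp only [deriv_circleMap, Function.uncurry_def]
    exact Continuous.smul (by fun_prop) (Continuous.smul (by fun_prop) hc)
  simp only [circleIntegral, ← intervalIntegral.integral_smul]
  rw [intervalIntegral_intervalIntegral_swap]
  · simp only [smul_comm (deriv (circleMap z r) _)]
  · exact (hF.continuousOn.integrableOn_compact (isCompact_uIcc.prod isCompact_uIcc)).mono_set
      (Set.prod_mono Set.uIoc_subset_uIcc Set.uIoc_subset_uIcc)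

theorem circleIntegral_sub_inv_of_notMem {z w : ℂ} {r : ℝ} (hr : 0 ≤ r)
    (hw : w ∉ closedBall z r) : (∮ ξ in C(z, r), (ξ - w)⁻¹) = 0 := by
  have hne : ∀ ξ ∈ closedBall z r, ξ - w ≠ 0 := fun ξ hξ h => hw (sub_eq_zero.1 h ▸ hξ)
  refine circleIntegral_eq_zero_of_differentiable_on_off_countable hr Set.countable_empty ?_ ?_
  · exact (continuousOn_id.sub continuousOn_const).inv₀ hne
  · intro ξ hξ
    exact (differentiableAt_id.sub_const w).inv (hne ξ (ball_subset_closedBall hξ.1))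

end CircleIntegral

/-! ### Riesz integrals and their products. -/

variable {X : Type*} [NormedAddCommGroup X] [InnerProductSpace ℂ X] [CompleteSpace X]
  {T : X →ₗ.[ℂ] X}

theorem circleIntegrable_resolventOp {z : ℂ} {r : ℝ} (hr : 0 ≤ r)
    (h : sphere z r ⊆ resolventSetOp T) : CircleIntegrable (resolventOp T) z r :=
  (continuousOn_resolventOp.mono h).circleIntegrable hr

omit [CompleteSpace X] in
theorem sphere_subset_resolventSetOp {z : ℂ} {r : ℝ} (hr : 0 < r)
    (h : closedBall z r ∩ spectrumOp T = {z}) : sphere z r ⊆ resolventSetOp T := by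
  intro ξ hξ
  by_contra hn
  have : ξ ∈ closedBall z r ∩ spectrumOp T := ⟨sphere_subset_closedBall hξ, hn⟩
  rw [h, Set.mem_singleton_iff] at this
  rw [this, mem_sphere, dist_self] at hξ
  exact hr.ne hξ

omit [CompleteSpace X] in
theorem closedBall_inter_spectrumOp_of_le {z : ℂ} {r R : ℝ} (hr : 0 ≤ r) (hle : r ≤ R)
    (h : closedBall z R ∩ spectrumOp T = {z}) : closedBall z r ∩ spectrumOp T = {z} := by
  have hz : z ∈ spectrumOp T := (h.symm ▸ Set.mem_singleton z :).2
  refine Set.Subset.antisymm ?_ ?_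
  · rw [← h]
    exact Set.inter_subset_inter_left _ (closedBall_subset_closedBall hle)
  · rintro _ rfl
    exact ⟨mem_closedBall_self hr, hz⟩

/-- The Riesz integral around an isolated point of the spectrum does not depend on the radius. -/
theorem rieszIntegral_eq_of_le {z : ℂ} {r R : ℝ} (hr : 0 < r) (hle : r ≤ R)
    (h : closedBall z R ∩ spectrumOp T = {z}) : rieszIntegral T z R = rieszIntegral T z r := by
  have hmem : ∀ ξ ∈ closedBall z R, ξ ≠ z → ξ ∈ resolventSetOp T := by
    intro ξ hξ hne
    by_contra hn
    exact hne (h.subset ⟨hξ, hn⟩)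
  rw [rieszIntegral, rieszIntegral,
    circleIntegral_eq_of_differentiable_on_annulus_off_countable hr hle Set.countable_empty]
  · intro ξ hξ
    refine (differentiableAt_resolventOp (hmem ξ hξ.1 ?_)).continuousAt.continuousWithinAt
    rintro rfl
    exact hξ.2 (mem_ball_self hr)
  · intro ξ hξ
    refine differentiableAt_resolventOp (hmem ξ (ball_subset_closedBall hξ.1.1) ?_)
    rintro rfl
    exact hξ.1.2 (mem_closedBall_self hr.le)

theorem rieszIntegral_eq {z : ℂ} {r R : ℝ} (hr : 0 < r) (hR : 0 < R)
    (h : closedBall z r ∩ spectrumOp T = {z}) (h' : closedBall z R ∩ spectrumOp T = {z}) :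
    rieszIntegral T z R = rieszIntegral T z r := by
  rcases le_total r R with hle | hle
  · exact rieszIntegral_eq_of_le hr hle h'
  · exact (rieszIntegral_eq_of_le hR hle h).symm

/-- Product of two circle integrals of the resolvent, for circles where the points of the first
are outside of the second or inside of it, and those of the second are outside of the first. -/
theorem circleIntegral_resolventOp_mul {z w : ℂ} {r ρ : ℝ} (hr : 0 ≤ r) (hρ : 0 ≤ ρ)
    (hz : sphere z r ⊆ resolventSetOp T) (hw : sphere w ρ ⊆ resolventSetOp T)
    (hout : ∀ η ∈ sphere w ρ, η ∉ closedBall z r) {c : ℂ}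
    (hc : ∀ ξ ∈ sphere z r, (∮ η in C(w, ρ), (η - ξ)⁻¹) = c) :
    (∮ ξ in C(z, r), resolventOp T ξ) * (∮ η in C(w, ρ), resolventOp T η) =
      c • ∮ ξ in C(z, r), resolventOp T ξ := by
  have hne : ∀ ξ ∈ sphere z r, ∀ η ∈ sphere w ρ, ξ ≠ η := fun ξ hξ η hη h =>
    hout η hη (h ▸ sphere_subset_closedBall hξ)
  have hcz := continuousOn_resolventOp.mono hz
  have hcw := continuousOn_resolventOp.mono hw
  have hiw := circleIntegrable_resolventOp hρ hw
  have hinv : ContinuousOn (fun p : ℂ × ℂ => (p.2 - p.1)⁻¹) (sphere z r ×ˢ sphere w ρ) :=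
    (continuousOn_snd.sub continuousOn_fst).inv₀ fun p hp =>
      sub_ne_zero.2 (hne p.1 hp.1 p.2 hp.2).symm
  have hinv1 : ∀ ξ ∈ sphere z r, ContinuousOn (fun η : ℂ => (η - ξ)⁻¹) (sphere w ρ) :=
    fun ξ hξ => (continuousOn_id.sub continuousOn_const).inv₀ fun η hη =>
      sub_ne_zero.2 (hne ξ hξ η hη).symm
  have hd : ContinuousOn (fun p : ℂ × ℂ => (p.2 - p.1)⁻¹ • resolventOp T p.2)
      (sphere z r ×ˢ sphere w ρ) :=
    hinv.smul (hcw.comp continuousOn_snd fun p hp => hp.2)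
  set Q := ∮ η in C(w, ρ), resolventOp T η with hQ
  have e1 : (∮ ξ in C(z, r), resolventOp T ξ) * Q = ∮ ξ in C(z, r), resolventOp T ξ * Q :=
    (circleIntegral_clm_comp ((ContinuousLinearMap.mul ℂ (X →L[ℂ] X)).flip Q)
      (circleIntegrable_resolventOp hr hz)).symm
  -- With ξ fixed, the resolvent identity splits the integrand; in the first part only the scalar (η
  -- - ξ)⁻¹ is integrated, which gives c.
  have e2 : ∀ ξ ∈ sphere z r, resolventOp T ξ * Q =
      c • resolventOp T ξ - ∮ η in C(w, ρ), (η - ξ)⁻¹ • resolventOp T η := by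
    intro ξ hξ
    have : resolventOp T ξ * Q = ∮ η in C(w, ρ), resolventOp T ξ * resolventOp T η :=
      (circleIntegral_clm_comp (ContinuousLinearMap.mul ℂ (X →L[ℂ] X) (resolventOp T ξ)) hiw).symm
    rw [this, circleIntegral.integral_congr hρ
        (fun η hη => resolventOp_mul (hz hξ) (hw hη) (hne ξ hξ η hη)),
      circleIntegral.integral_sub, circleIntegral.integral_smul_const, hc ξ hξ]
    · exact ((hinv1 ξ hξ).smul continuousOn_const).circleIntegrable hρ
    · exact ((hinv1 ξ hξ).smul hcw).circleIntegrable hρ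
  -- After exchanging the integrals, (η - ξ)⁻¹ is holomorphic in ξ on the first disc, because η lies
  -- outside it.
  have e3 : (∮ ξ in C(z, r), ∮ η in C(w, ρ), (η - ξ)⁻¹ • resolventOp T η) = 0 := by
    rw [circleIntegral_swap (f := fun ξ η => (η - ξ)⁻¹ • resolventOp T η) hr hρ hd]
    have : ∀ η ∈ sphere w ρ, (∮ ξ in C(z, r), (η - ξ)⁻¹ • resolventOp T η) = 0 := by
      intro η hη
      have h0 := circleIntegral_sub_inv_of_notMem hr (hout η hη)
      simp only [← neg_sub _ η, inv_neg, circleIntegral.integral_smul_const]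
      have : (∮ ξ in C(z, r), -(ξ - η)⁻¹) = 0 := by
        simpa [circleIntegral] using h0
      rw [this, zero_smul]
    rw [circleIntegral.integral_congr hρ this]
    simp [circleIntegral]
  have e4 : ∀ ξ ∈ sphere z r, (∮ η in C(w, ρ), (η - ξ)⁻¹ • resolventOp T η) =
      c • resolventOp T ξ - resolventOp T ξ * Q := fun ξ hξ => by rw [e2 ξ hξ, sub_sub_cancel]
  rw [circleIntegral.integral_congr hr e4, circleIntegral.integral_sub,
    circleIntegral.integral_smul, ← e1, sub_eq_zero] at e3
  · exact e3.symm
  · exact (hcz.const_smul c).circleIntegrable hr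
  · exact (hcz.mul continuousOn_const).circleIntegrable hr

theorem rieszIntegral_mul_of_disjoint {z w : ℂ} {r ρ : ℝ} (hr : 0 ≤ r) (hρ : 0 ≤ ρ)
    (hz : sphere z r ⊆ resolventSetOp T) (hw : sphere w ρ ⊆ resolventSetOp T)
    (hd : Disjoint (closedBall z r) (closedBall w ρ)) :
    rieszIntegral T z r * rieszIntegral T w ρ = 0 := by
  rw [rieszIntegral, rieszIntegral, smul_mul_smul_comm,
    circleIntegral_resolventOp_mul hr hρ hz hw (c := 0), zero_smul, smul_zero]
  · exact fun η hη h => Set.disjoint_left.1 hd h (sphere_subset_closedBall hη)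
  · exact fun ξ hξ => circleIntegral_sub_inv_of_notMem hρ
      (Set.disjoint_left.1 hd (sphere_subset_closedBall hξ))

/-- The two factors are taken over circles of radii r / 2 and r, since the product formula needs the
second circle outside the first disc. Independence of the radius then identifies them. -/
theorem isIdempotentElem_rieszIntegral {z : ℂ} {r : ℝ} (hr : 0 < r)
    (h : closedBall z r ∩ spectrumOp T = {z}) : IsIdempotentElem (rieszIntegral T z r) := by
  have h2 := closedBall_inter_spectrumOp_of_le (half_pos hr).le (half_le_self hr.le) h
  have key : rieszIntegral T z (r / 2) * rieszIntegral T z r = rieszIntegral T z (r / 2) := by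
    rw [rieszIntegral, rieszIntegral, smul_mul_smul_comm,
      circleIntegral_resolventOp_mul (half_pos hr).le hr.le
        (sphere_subset_resolventSetOp (half_pos hr) h2) (sphere_subset_resolventSetOp hr h)
        (c := 2 * Real.pi * I), smul_smul, mul_assoc, inv_mul_cancel₀ two_pi_I_ne_zero, mul_one]
    · intro η hη h'
      rw [mem_sphere] at hη
      rw [mem_closedBall, hη] at h'
      linarith
    · intro ξ hξ
      refine circleIntegral.integral_sub_inv_of_mem_ball ?_
      rw [mem_sphere] at hξ
      rw [mem_ball, hξ]
      linarith
  rw [rieszIntegral_eq hr (half_pos hr) h h2] at key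
  exact key

theorem rieszIntegral_apply {z : ℂ} {r : ℝ} (hr : 0 ≤ r) (h : sphere z r ⊆ resolventSetOp T)
    (f : X) : rieszIntegral T z r f =
      (2 * Real.pi * I : ℂ)⁻¹ • ∮ ξ in C(z, r), resolventOp T ξ f := by
  rw [rieszIntegral, smul_apply]
  congr 1
  exact (circleIntegral_clm_comp (ContinuousLinearMap.apply ℂ X f)
    (circleIntegrable_resolventOp hr h)).symm

theorem rieszIntegral_eigenvector {z w : ℂ} {r : ℝ} (hr : 0 < r)
    (h : sphere w r ⊆ resolventSetOp T) (hz : z ∉ sphere w r) {u : T.domain}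
    (hu : T u = z • (u : X)) : rieszIntegral T w r u =
      ((2 * Real.pi * I : ℂ)⁻¹ * ∮ ξ in C(w, r), (ξ - z)⁻¹) • (u : X) := by
  rw [rieszIntegral_apply hr.le h, mul_smul, ← circleIntegral.integral_smul_const]
  congr 1
  exact circleIntegral.integral_congr hr.le fun ξ hξ =>
    resolventOp_eigenvector (h hξ) (ne_of_mem_of_not_mem hξ hz) hu

end KreinCont

namespace KreinCont

open Complex Metric MeasureTheory ComplexConjugate

variable {X : Type*} [NormedAddCommGroup X] [InnerProductSpace ℂ X]

/-! ### Self-adjointness of Riesz projections for the Krein form. -/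

section KreinSymmetry

variable {T : X →ₗ.[ℂ] X} {K : X →L[ℂ] X}
  (hK : ∀ u v, inner ℂ (K u) v = -inner ℂ u (K v))
  (hT : ∀ u v : T.domain, inner ℂ (K (T u)) (v : X) = inner ℂ (u : X) (K (T v)))

include hK hT

/-- The Krein adjoint of the resolvent of an operator that is skew for the Krein form. -/
theorem inner_resolventOp_left {ξ : ℂ} (hξ : ξ ∈ resolventSetOp T)
    (hξ' : -conj ξ ∈ resolventSetOp T) (f g : X) :
    inner ℂ (resolventOp T ξ f) (K g) = -inner ℂ f (K (resolventOp T (-conj ξ) g)) := by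
  have hu := apply_resolventOp hξ f
  have hv := apply_resolventOp hξ' g
  set u : T.domain := ⟨resolventOp T ξ f, resolventOp_mem hξ f⟩
  set v : T.domain := ⟨resolventOp T (-conj ξ) g, resolventOp_mem hξ' g⟩
  have h := hT u v
  rw [hK, hu, hv] at h
  simp only [map_sub, map_smul, inner_sub_left, inner_sub_right, inner_smul_left,
    inner_smul_right] at h
  change -(conj ξ * inner ℂ (resolventOp T ξ f) (K (resolventOp T (-conj ξ) g)) -
    inner ℂ f (K (resolventOp T (-conj ξ) g))) =
      -conj ξ * inner ℂ (resolventOp T ξ f) (K (resolventOp T (-conj ξ) g)) -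
      inner ℂ (resolventOp T ξ f) (K g) at h
  linear_combination h

/-- The reflection ξ ↦ -conj ξ preserves a circle centred on the imaginary axis and exchanges the
resolvent with minus its Krein adjoint. That sign cancels the one from conjugating 2πi. -/
theorem inner_rieszIntegral_left [CompleteSpace X] {z : ℂ} {r : ℝ} (hz : z.re = 0) (hr : 0 ≤ r)
    (h : sphere z r ⊆ resolventSetOp T) (f g : X) :
    inner ℂ (rieszIntegral T z r f) (K g) = inner ℂ f (K (rieszIntegral T z r g)) := by
  have hpair : ∀ a b : X, inner ℂ a (rieszIntegral T z r b) = (2 * Real.pi * I : ℂ)⁻¹ *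
      ∫ θ in (0 : ℝ)..2 * Real.pi,
        circleMap 0 r θ * I * inner ℂ a (resolventOp T (circleMap z r θ) b) := by
    intro a b
    have := circleIntegral_clm_comp ((innerSL ℂ a).comp (ContinuousLinearMap.apply ℂ X b))
      (circleIntegrable_resolventOp hr h)
    rw [rieszIntegral, smul_apply, inner_smul_right]
    congr 1
    refine this.symm.trans ?_
    simp only [circleIntegral, deriv_circleMap, smul_eq_mul]
    rfl
  have hKadj : ∀ a b : X, inner ℂ a (K b) = -inner ℂ (K a) b := fun a b => by rw [hK, neg_neg]
  set F : ℝ → ℂ := fun θ =>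
    circleMap 0 r θ * I * inner ℂ f (K (resolventOp T (circleMap z r θ) g)) with hF
  have hright : inner ℂ f (K (rieszIntegral T z r g)) =
      (2 * Real.pi * I : ℂ)⁻¹ * ∫ θ in (0 : ℝ)..2 * Real.pi, F θ := by
    rw [hKadj, hpair, ← mul_neg, ← intervalIntegral.integral_neg]
    simp only [hF, hKadj f, mul_neg]
  -- In the angular parameter the reflection is θ ↦ π - θ. It is applied with c = z to the resolvent
  -- and with c = 0 to the derivative of the parametrization.
  have hrefl : ∀ (c : ℂ) (θ : ℝ), c.re = 0 → circleMap c r (Real.pi - θ) =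
      -conj (circleMap c r θ) := by
    intro c θ hc
    have hcc : conj c = -c := by
      apply Complex.ext <;> simp [hc]
    simp only [circleMap, map_add, map_mul, conj_ofReal, hcc, ← exp_conj, conj_I]
    push_cast
    rw [sub_mul, exp_sub, exp_pi_mul_I, mul_neg, exp_neg]
    ring
  have hper : Function.Periodic F (2 * Real.pi) := by
    intro θ
    simp only [hF, periodic_circleMap _ _ θ]
  have hleft : inner ℂ (rieszIntegral T z r f) (K g) =
      (2 * Real.pi * I : ℂ)⁻¹ * ∫ θ in (0 : ℝ)..2 * Real.pi, F (Real.pi - θ) := by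
    rw [← inner_conj_symm, hpair, map_mul, ← intervalIntegral.intervalIntegral_conj]
    have hc : conj (2 * Real.pi * I : ℂ)⁻¹ = -(2 * Real.pi * I : ℂ)⁻¹ := by
      simp only [map_inv₀, map_mul, map_ofNat, conj_ofReal, conj_I, mul_neg, inv_neg]
    rw [hc, neg_mul, ← mul_neg, ← intervalIntegral.integral_neg]
    congr 2
    ext θ
    have hm : ∀ φ, circleMap z r φ ∈ resolventSetOp T := fun φ => h (circleMap_mem_sphere z hr φ)
    rw [map_mul, inner_conj_symm, inner_resolventOp_left hK hT (hm θ) (hrefl z θ hz ▸ hm _)]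
    simp only [hF, hrefl z θ hz, hrefl 0 θ zero_re, map_mul, conj_I]
    ring
  -- The substitution moves the integral to [-π, π]; periodicity moves it back to [0, 2π].
  rw [hleft, hright, intervalIntegral.integral_comp_sub_left]
  have := hper.intervalIntegral_add_eq (-Real.pi) 0
  rw [zero_add] at this
  rw [← this, sub_zero]
  congr 3 <;> ring

end KreinSymmetry

/-! ### Continuous dependence of Riesz integrals on the operator. -/

section Continuity

variable [CompleteSpace X] {α : Type*} [TopologicalSpace α]

/-- Continuity at the single point ξ₀ suffices: R(ξ) = R(ξ₀) (1 + (ξ - ξ₀) R(ξ₀))⁻¹ is jointly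
continuous in s and ξ, and so can be integrated over the fixed circle. -/
theorem continuousOn_rieszIntegral {T : α → X →ₗ.[ℂ] X} {V : Set α} {ξ₀ z : ℂ} {r : ℝ}
    (hr : 0 ≤ r) (hξ₀ : ∀ s ∈ V, ξ₀ ∈ resolventSetOp (T s))
    (hc : ContinuousOn (fun s => resolventOp (T s) ξ₀) V)
    (hV : ∀ s ∈ V, sphere z r ⊆ resolventSetOp (T s)) :
    ContinuousOn (fun s => rieszIntegral (T s) z r) V := by
  rw [continuousOn_iff_continuous_domRestrict] at hc ⊢
  have hm : ∀ (s : V) (θ : ℝ), circleMap z r θ ∈ resolventSetOp (T s) :=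
    fun s θ => hV s s.2 (circleMap_mem_sphere z hr θ)
  have hres : Continuous fun p : V × ℝ => resolventOp (T p.1) (circleMap z r p.2) := by
    have hfst : Continuous fun p : V × ℝ => resolventOp (T p.1) ξ₀ := hc.comp continuous_fst
    have hin : Continuous fun p : V × ℝ =>
        1 + (circleMap z r p.2 - ξ₀) • resolventOp (T p.1) ξ₀ :=
      continuous_const.add
        ((((continuous_circleMap z r).comp continuous_snd).sub continuous_const).smul hfst)
    have hinv : Continuous fun p : V × ℝ =>
        Ring.inverse (1 + (circleMap z r p.2 - ξ₀) • resolventOp (T p.1) ξ₀) := by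
      rw [continuous_iff_continuousAt]
      intro p
      obtain ⟨u, hu⟩ := isUnit_one_add_smul_resolventOp (hm p.1 p.2) (hξ₀ p.1 p.1.2)
      have h := NormedRing.inverse_continuousAt u
      rw [hu] at h
      exact ContinuousAt.comp (f := fun p : V × ℝ =>
        1 + (circleMap z r p.2 - ξ₀) • resolventOp (T p.1) ξ₀) h hin.continuousAt
    refine (hfst.mul hinv).congr fun p => ?_
    exact (resolventOp_eq_mul_inverse (hm p.1 p.2) (hξ₀ p.1 p.1.2)).symm
  refine Continuous.const_smul (c := (2 * Real.pi * I : ℂ)⁻¹) ?_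
  refine intervalIntegral.continuous_parametric_intervalIntegral_of_continuous'
    (f := fun (s : V) (θ : ℝ) => deriv (circleMap z r) θ • resolventOp (T s) (circleMap z r θ))
    ?_ _ _
  simp only [deriv_circleMap, Function.uncurry_def]
  exact (((continuous_circleMap 0 r).comp continuous_snd).mul continuous_const).smul hres

end Continuity

/-! ### Spectral projections of a finite system of eigenvalues. -/

section System

variable {T : ℝ → X →ₗ.[ℂ] X} {I' : Set ℝ} {Sig : ℝ → Finset ℂ} {P : ℝ → X →L[ℂ] X}

namespace IsFiniteEigenvalueSystem

theorem exists_radius (hsys : IsFiniteEigenvalueSystem T I' Sig P) {s : ℝ} (hs : s ∈ I') :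
    ∃ ε > 0, (∀ z ∈ Sig s, ∀ w ∈ Sig s, z ≠ w → Disjoint (closedBall z ε) (closedBall w ε)) ∧
      (∀ z ∈ Sig s, closedBall z ε ∩ spectrumOp (T s) = {z}) ∧
      P s = ∑ z ∈ Sig s, rieszIntegral (T s) z ε := by
  obtain ⟨ε, hε, hd, hi, he⟩ := hsys.contour s hs
  exact ⟨ε, hε, hd, hi, (he.self_of_nhdsWithin hs).2⟩

variable [CompleteSpace X]

/-- On an eigenvector the resolvent is multiplication by (ξ - z)⁻¹, so only the circle around z
contributes. This places eigenvectors in X₁, where definiteness applies to them. -/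
theorem apply_eigenvector (hsys : IsFiniteEigenvalueSystem T I' Sig P) {s : ℝ} (hs : s ∈ I')
    {z : ℂ} (hz : z ∈ Sig s) {u : (T s).domain} (hu : T s u = z • (u : X)) : P s u = u := by
  obtain ⟨ε, hε, hd, hi, he⟩ := hsys.exists_radius hs
  have hsph := fun w hw => sphere_subset_resolventSetOp hε (hi w hw)
  rw [he, sum_apply, Finset.sum_eq_single z]
  · rw [rieszIntegral_eigenvector hε (hsph z hz) _ hu,
      circleIntegral.integral_sub_inv_of_mem_ball (mem_ball_self hε),
      inv_mul_cancel₀ two_pi_I_ne_zero, one_smul]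
    simpa using hε.ne
  · intro w hw hwz
    have hzw : z ∉ closedBall w ε :=
      Set.disjoint_left.1 (hd z hz w hw hwz.symm) (mem_closedBall_self hε.le)
    rw [rieszIntegral_eigenvector hε (hsph w hw) (fun h => hzw (sphere_subset_closedBall h)) hu,
      circleIntegral_sub_inv_of_notMem hε.le hzw, mul_zero, zero_smul]
  · exact fun h => absurd hz h

theorem isIdempotentElem (hsys : IsFiniteEigenvalueSystem T I' Sig P) {s : ℝ} (hs : s ∈ I') :
    IsIdempotentElem (P s) := by
  obtain ⟨ε, hε, hd, hi, he⟩ := hsys.exists_radius hs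
  have hsph := fun w hw => sphere_subset_resolventSetOp hε (hi w hw)
  rw [IsIdempotentElem, he, Finset.sum_mul_sum]
  refine Finset.sum_congr rfl fun z hz => ?_
  rw [Finset.sum_eq_single_of_mem z hz]
  · exact isIdempotentElem_rieszIntegral hε (hi z hz)
  · exact fun w hw hwz => rieszIntegral_mul_of_disjoint hε.le hε.le (hsph z hz) (hsph w hw)
      (hd z hz w hw hwz.symm)

theorem apply_of_mem (hsys : IsFiniteEigenvalueSystem T I' Sig P) {s : ℝ} (hs : s ∈ I') {u : X}
    (hu : u ∈ spectralSubspace (P s)) : P s u = u := by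
  obtain ⟨v, rfl⟩ := hu
  exact congrArg (fun A : X →L[ℂ] X => A v) (hsys.isIdempotentElem hs)

theorem finiteDimensional (hsys : IsFiniteEigenvalueSystem T I' Sig P) {s : ℝ} (hs : s ∈ I') :
    FiniteDimensional ℂ (spectralSubspace (P s)) := by
  obtain ⟨ε, hε, hd, hi, he⟩ := hsys.exists_radius hs
  -- Finite rank is known for a radius attached to z alone, not for the common radius ε of the
  -- contour; the Riesz integrals agree.
  have hfin : ∀ z ∈ Sig s,
      FiniteDimensional ℂ (LinearMap.range (rieszIntegral (T s) z ε).toLinearMap) := by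
    intro z hz
    obtain ⟨-, r, hr, hir, hf⟩ := hsys.discrete s hs z hz
    rwa [rieszIntegral_eq hr hε hir (hi z hz)]
  have hle : spectralSubspace (P s) ≤
      ⨆ z : Sig s, LinearMap.range (rieszIntegral (T s) z ε).toLinearMap := by
    rintro _ ⟨u, rfl⟩
    rw [he]
    simp only [ContinuousLinearMap.coe_coe, sum_apply]
    exact Submodule.sum_mem _ fun z hz =>
      Submodule.mem_iSup_of_mem (⟨z, hz⟩ : Sig s) ⟨u, rfl⟩
  have : ∀ z : Sig s, FiniteDimensional ℂ (LinearMap.range (rieszIntegral (T s) z ε).toLinearMap) :=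
    fun z => hfin z z.2
  exact Submodule.finiteDimensional_of_le hle

theorem continuousOn (hsys : IsFiniteEigenvalueSystem T I' Sig P) {I : Set ℝ} (hI : I' ⊆ I)
    (hcont : ResolventContinuousOn T I) : ContinuousOn P I' := by
  intro s hs
  obtain ⟨ε, hε, -, -, he⟩ := hsys.contour s hs
  obtain ⟨ξ₀, U, hU, hξ₀, hc⟩ := hcont.2 s (hI hs)
  set V := {t | t ∈ U ∧ t ∈ I' ∧ ∀ z ∈ Sig s, sphere z ε ⊆ resolventSetOp (T t)}
  have hV : V ∈ 𝓝[I'] s := by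
    filter_upwards [he, mem_nhdsWithin_of_mem_nhds hU, self_mem_nhdsWithin] with t h1 h2 h3
    exact ⟨h2, h3, h1.1⟩
  have hVU : V ⊆ U ∩ I := fun t ht => ⟨ht.1, hI ht.2.1⟩
  have hsum : ContinuousOn (fun t => ∑ z ∈ Sig s, rieszIntegral (T t) z ε) V :=
    continuousOn_finsetSum _ fun z hz => continuousOn_rieszIntegral hε.le
      (fun t ht => hξ₀ t (hVU ht)) (hc.mono hVU) fun t ht => ht.2.2 z hz
  refine ((hsum s (mem_of_mem_nhdsWithin hs hV)).mono_of_mem_nhdsWithin hV).congr_of_eventuallyEq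
    (he.mono fun t ht => ht.2) (he.self_of_nhdsWithin hs).2

theorem inner_apply_left (hsys : IsFiniteEigenvalueSystem T I' Sig P) {s : ℝ} (hs : s ∈ I')
    {K : X →L[ℂ] X} (hK : ∀ u v, inner ℂ (K u) v = -inner ℂ u (K v))
    (hT : ∀ u v : (T s).domain, inner ℂ (K (T s u)) (v : X) = inner ℂ (u : X) (K (T s v)))
    (him : ∀ z ∈ Sig s, z.re = 0) (f g : X) :
    inner ℂ (P s f) (K g) = inner ℂ f (K (P s g)) := by
  obtain ⟨ε, hε, hd, hi, he⟩ := hsys.exists_radius hs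
  rw [he, sum_apply, sum_apply, map_sum, sum_inner,
    inner_sum]
  exact Finset.sum_congr rfl fun z hz => inner_rieszIntegral_left hK hT (him z hz) hε.le
    (sphere_subset_resolventSetOp hε (hi z hz)) f g

/-- For an eigenvector u, skewness of T gives (z + conj z) [u, u] = 0, and [u, u] ≠ 0 by
definiteness. -/
theorem re_eq_zero (hsys : IsFiniteEigenvalueSystem T I' Sig P) {s : ℝ} (hs : s ∈ I')
    {K : X →L[ℂ] X} (hK : ∀ u v, inner ℂ (K u) v = -inner ℂ u (K v))
    (hT : ∀ u v : (T s).domain, inner ℂ (K (T s u)) (v : X) = inner ℂ (u : X) (K (T s v)))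
    (hpos : PosDefOn K (spectralSubspace (P s))) {z : ℂ} (hz : z ∈ Sig s) : z.re = 0 := by
  obtain ⟨⟨u, hu0, hu⟩, -⟩ := hsys.discrete s hs z hz
  have hq := hpos u ⟨u, hsys.apply_eigenvector hs hz hu⟩ hu0
  have h := hT u u
  rw [hu, map_smul, inner_smul_left, inner_smul_right, hK] at h
  have hq0 : inner ℂ (u : X) (K u) ≠ 0 := by
    intro h0
    rw [kreinForm, inner_smul_right, h0, mul_zero, zero_re] at hq
    exact hq.false
  have h2 : (z + conj z) * inner ℂ (u : X) (K u) = 0 := by linear_combination -h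
  rw [add_conj, mul_eq_zero, or_iff_left hq0, ofReal_eq_zero] at h2
  linarith

end IsFiniteEigenvalueSystem

end System

end KreinCont

namespace KreinCont

open Complex Metric ComplexConjugate

variable {X : Type*} [NormedAddCommGroup X] [InnerProductSpace ℂ X]

/-! ### Definiteness of the Krein form under perturbations and limits. -/

section Form

variable {K : X →L[ℂ] X}

theorem continuous_kreinForm : Continuous (kreinForm K) := by
  unfold kreinForm
  fun_prop

theorem kreinForm_smul (t : ℝ) (u : X) : kreinForm K ((t : ℂ) • u) = t ^ 2 * kreinForm K u := by
  rw [kreinForm, kreinForm, map_smul, smul_comm I, inner_smul_left, inner_smul_right, conj_ofReal,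
    ← mul_assoc, ← ofReal_mul, re_ofReal_mul, sq]

theorem kreinForm_neg (u : X) : kreinForm (-K) u = -kreinForm K u := by
  rw [kreinForm, kreinForm, neg_apply, smul_neg, inner_neg_right, neg_re]

theorem kreinForm_add_smul (hK : ∀ u v, inner ℂ (K u) v = -inner ℂ u (K v)) (v w : X) (t : ℝ) :
    kreinForm K (v + (t : ℂ) • w) =
      kreinForm K w * (t * t) + 2 * (inner ℂ w (I • K v)).re * t + kreinForm K v := by
  have h : (inner ℂ v (I • K w)).re = (inner ℂ w (I • K v)).re := by
    rw [← conj_re, inner_conj_symm, inner_smul_left, hK, inner_smul_right, conj_I, neg_mul_neg]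
  simp only [kreinForm, map_add, map_smul, smul_add, inner_add_left, inner_add_right,
    smul_comm I (t : ℂ), inner_smul_left _ _ (t : ℂ), inner_smul_right _ _ (t : ℂ), conj_ofReal,
    add_re, re_ofReal_mul, h]
  ring

theorem kreinForm_sub_le (u v : X) :
    kreinForm K u - kreinForm K v ≤ ‖K‖ * ‖u - v‖ * (‖u‖ + ‖v‖) := by
  have h : kreinForm K u - kreinForm K v =
      (inner ℂ (u - v) (I • K u)).re + (inner ℂ v (I • K (u - v))).re := by
    simp only [kreinForm, map_sub, smul_sub, inner_sub_left, inner_sub_right, sub_re]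
    ring
  have h1 : (inner ℂ (u - v) (I • K u)).re ≤ ‖u - v‖ * (‖K‖ * ‖u‖) := by
    refine (re_le_norm _).trans ((norm_inner_le_norm _ _).trans ?_)
    rw [norm_smul, norm_I, one_mul]
    gcongr
    exact K.le_opNorm u
  have h2 : (inner ℂ v (I • K (u - v))).re ≤ ‖v‖ * (‖K‖ * ‖u - v‖) := by
    refine (re_le_norm _).trans ((norm_inner_le_norm _ _).trans ?_)
    rw [norm_smul, norm_I, one_mul]
    gcongr
    exact K.le_opNorm _
  rw [h]
  linarith

/-- If the Krein form is nonnegative on the range of a Krein self-adjoint projection, then it is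
positive definite there. -/
theorem posDefOn_of_nonneg (hK : ∀ u v, inner ℂ (K u) v = -inner ℂ u (K v))
    (hinj : Function.Injective K) {Q : X →L[ℂ] X} (hQ : ∀ u ∈ spectralSubspace Q, Q u = u)
    (hsa : ∀ f g, inner ℂ (Q f) (K g) = inner ℂ f (K (Q g)))
    (hnn : ∀ u, 0 ≤ kreinForm K (Q u)) : PosDefOn K (spectralSubspace Q) := by
  intro v hv hv0
  have hQv := hQ v hv
  refine lt_of_le_of_ne (hQv ▸ hnn v) fun h0 => hv0 (hinj ?_)
  -- This is the test vector in the range of Q that detects Kv: self-adjointness of Q and Qv = v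
  -- make its pairing with iKv equal to ‖Kv‖².
  set w := Q (I • K v)
  have hw : inner ℂ w (I • K v) = ((‖K v‖ ^ 2 : ℝ) : ℂ) := by
    rw [inner_smul_right, hsa, hQv, inner_smul_left, conj_I, ← mul_assoc, mul_neg, I_mul_I,
      neg_neg, one_mul, inner_self_eq_norm_sq_to_K]
    simp
  -- As v is null, the form at v + tw is a quadratic in t without constant term. Being nonnegative
  -- for all real t, it has no linear term either.
  have hdisc := discrim_le_zero (a := kreinForm K w) (b := 2 * ‖K v‖ ^ 2) (c := 0) fun t => by
    have := hnn (v + (t : ℂ) • (I • K v))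
    rwa [map_add, map_smul, hQv, kreinForm_add_smul hK, hw, ofReal_re, ← h0] at this
  rw [discrim, mul_zero, sub_zero] at hdisc
  have h2 : 2 * ‖K v‖ ^ 2 = 0 := pow_eq_zero_iff two_ne_zero |>.1 (hdisc.antisymm (sq_nonneg _))
  rw [map_zero, ← norm_eq_zero]
  simpa using h2

/-- The form attains a positive minimum on the compact unit sphere of V; homogeneity of degree two
does the rest. -/
theorem PosDefOn.exists_le {V : Submodule ℂ X} [FiniteDimensional ℂ V] (h : PosDefOn K V) :
    ∃ c > 0, ∀ u ∈ V, c * ‖u‖ ^ 2 ≤ kreinForm K u := by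
  have : ProperSpace V := FiniteDimensional.proper ℂ V
  have hcont : Continuous fun u : V => kreinForm K u :=
    continuous_kreinForm.comp continuous_subtype_val
  obtain ⟨c, hc, hle⟩ := (isCompact_sphere (0 : V) 1).exists_forall_le' (a := 0)
    hcont.continuousOn fun u hu => h u u.2 fun h0 => by
      rw [mem_sphere_zero_iff_norm, Submodule.coe_norm, h0, norm_zero] at hu
      exact zero_ne_one hu
  refine ⟨c, hc, fun u hu => ?_⟩
  rcases eq_or_ne u 0 with rfl | hu0
  · simp [kreinForm]
  have hn : ‖u‖ ≠ 0 := norm_ne_zero_iff.2 hu0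
  have h1 := hle (((‖u‖⁻¹ : ℝ) : ℂ) • (⟨u, hu⟩ : V)) (by
    rw [mem_sphere_zero_iff_norm, norm_smul, Complex.norm_real, norm_inv, norm_norm]
    exact inv_mul_cancel₀ hn)
  rw [Submodule.coe_smul, kreinForm_smul, inv_pow, inv_mul_eq_div, le_div_iff₀ (by positivity)] at h1
  exact h1

/-- Positive definiteness on the range of a projection of finite rank is stable under small
perturbations of the projection in norm. -/
theorem PosDefOn.eventually {Q : X →L[ℂ] X} [FiniteDimensional ℂ (spectralSubspace Q)]
    (h : PosDefOn K (spectralSubspace Q)) : ∀ᶠ R in 𝓝 Q,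
      (∀ u ∈ spectralSubspace R, R u = u) → PosDefOn K (spectralSubspace R) := by
  obtain ⟨c, hc, hle⟩ := h.exists_le
  have h1 : ∀ᶠ R in 𝓝 Q, ‖R - Q‖ < 1 :=
    (by fun_prop : Continuous fun R : X →L[ℂ] X => ‖R - Q‖).continuousAt.eventually_lt
      continuousAt_const (by simp)
  -- With δ = ‖R - Q‖ and Ru = u, the bounds (1 - δ)‖u‖ ≤ ‖Qu‖ ≤ (1 + δ)‖u‖ and ‖Qu - u‖ ≤ δ‖u‖ show
  -- that the form at u is at least this expression times ‖u‖². At R = Q it equals c.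
  have h2 : ∀ᶠ R in 𝓝 Q, 0 < c * (1 - ‖R - Q‖) ^ 2 - ‖K‖ * ‖R - Q‖ * (2 + ‖R - Q‖) :=
    ContinuousAt.eventually_lt continuousAt_const
      (by fun_prop : Continuous fun R : X →L[ℂ] X =>
        c * (1 - ‖R - Q‖) ^ 2 - ‖K‖ * ‖R - Q‖ * (2 + ‖R - Q‖)).continuousAt (by simpa using hc)
  filter_upwards [h1, h2] with R h1 h2 hR u hu hu0
  set δ := ‖R - Q‖
  have hδ : 0 ≤ δ := norm_nonneg _
  have hup : 0 < ‖u‖ := norm_pos_iff.2 hu0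
  have hd : ‖Q u - u‖ ≤ δ * ‖u‖ := by
    have := (R - Q).le_opNorm u
    rwa [sub_apply, hR u hu, norm_sub_rev] at this
  have hlow : (1 - δ) * ‖u‖ ≤ ‖Q u‖ := by
    have := norm_sub_norm_le u (Q u)
    rw [norm_sub_rev] at this
    linarith
  have hupp : ‖Q u‖ ≤ (1 + δ) * ‖u‖ := by
    have := norm_sub_norm_le (Q u) u
    linarith
  have hs := kreinForm_sub_le (K := K) (Q u) u
  have hq := hle (Q u) ⟨u, rfl⟩
  have ha : c * ((1 - δ) * ‖u‖) ^ 2 ≤ c * ‖Q u‖ ^ 2 := by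
    have : 0 ≤ (1 - δ) * ‖u‖ := mul_nonneg (by linarith) hup.le
    gcongr
  have hb : ‖K‖ * ‖Q u - u‖ * (‖Q u‖ + ‖u‖) ≤ ‖K‖ * (δ * ‖u‖) * ((1 + δ) * ‖u‖ + ‖u‖) := by
    gcongr
  have hp : 0 < (c * (1 - δ) ^ 2 - ‖K‖ * δ * (2 + δ)) * ‖u‖ ^ 2 := by positivity
  linarith

theorem negDefOn_iff {V : Submodule ℂ X} : NegDefOn K V ↔ PosDefOn (-K) V := by
  simp only [NegDefOn, PosDefOn, kreinForm_neg, neg_pos]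

end Form

/-! ### Propagation of definiteness along the interval. -/

variable [CompleteSpace X]

/-- For a family of operators that are skew for the Krein form of `K`, positive definiteness of the
form on the spectral subspaces of a finite system of eigenvalues propagates along the interval. -/
theorem posDefOn_spectralSubspace {T : ℝ → X →ₗ.[ℂ] X} {I I' : Set ℝ} {Sig : ℝ → Finset ℂ}
    {P : ℝ → X →L[ℂ] X} (hcont : ResolventContinuousOn T I) (hI' : I'.OrdConnected)
    (hI'I : I' ⊆ I) (hsys : IsFiniteEigenvalueSystem T I' Sig P) {K : X →L[ℂ] X}
    (hK : ∀ u v, inner ℂ (K u) v = -inner ℂ u (K v)) (hinj : Function.Injective K)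
    (hT : ∀ s ∈ I', ∀ u v : (T s).domain,
      inner ℂ (K (T s u)) (v : X) = inner ℂ (u : X) (K (T s v)))
    {s₀ : ℝ} (hs₀ : s₀ ∈ I') (h₀ : PosDefOn K (spectralSubspace (P s₀))) {s : ℝ} (hs : s ∈ I') :
    PosDefOn K (spectralSubspace (P s)) := by
  have hP : Continuous fun t : I' => P t :=
    continuousOn_iff_continuous_domRestrict.1 (hsys.continuousOn hI'I hcont)
  have hPu : ∀ u, Continuous fun t : I' => P t u := fun u => hP.clm_apply continuous_const
  set A : Set I' := {t | PosDefOn K (spectralSubspace (P t))} with hA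
  have hopen : IsOpen A := by
    refine isOpen_iff_eventually.2 fun t ht => ?_
    have := hsys.finiteDimensional t.2
    exact (hP.continuousAt.eventually (PosDefOn.eventually ht)).mono fun r hr =>
      hr fun u => hsys.apply_of_mem r.2
  have hclosed : IsClosed A := by
    -- Strict positivity is not a closed condition, so A is rewritten through two conditions that
    -- are. Self-adjointness of P is available on A because definiteness makes the eigenvalues
    -- imaginary there.
    have heq : A = {t : I' | ∀ u, 0 ≤ kreinForm K (P t u)} ∩
        {t : I' | ∀ f g, inner ℂ (P t f) (K g) = inner ℂ f (K (P t g))} := by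
      ext t
      refine ⟨fun ht => ⟨fun u => ?_, ?_⟩, fun ht => ?_⟩
      · rcases eq_or_ne (P t u) 0 with h0 | h0
        · simp [h0, kreinForm]
        · exact (ht _ ⟨u, rfl⟩ h0).le
      · exact hsys.inner_apply_left t.2 hK (hT t t.2)
          fun z hz => hsys.re_eq_zero t.2 hK (hT t t.2) ht hz
      · exact posDefOn_of_nonneg hK hinj (fun u => hsys.apply_of_mem t.2) ht.2 ht.1
    rw [heq]
    simp only [Set.ofPred_forall]
    refine IsClosed.inter (isClosed_iInter fun u => ?_)
      (isClosed_iInter fun f => isClosed_iInter fun g => ?_)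
    · exact isClosed_le continuous_const (continuous_kreinForm.comp (hPu u))
    · exact isClosed_eq ((hPu f).inner continuous_const)
        (continuous_const.inner (K.continuous.comp (hPu g)))
  have : PreconnectedSpace I' := Subtype.preconnectedSpace hI'.isPreconnected
  have huniv := IsClopen.eq_univ ⟨hclosed, hopen⟩ ⟨⟨s₀, hs₀⟩, h₀⟩
  exact (huniv ▸ Set.mem_univ (⟨s, hs⟩ : I') : (⟨s, hs⟩ : I') ∈ A)

omit [CompleteSpace X] in
theorem IsSkewSymmetricOp.inner_boundedInverse {J : X →ₗ.[ℂ] X} (hJ : IsSkewSymmetricOp J)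
    {R : X →L[ℂ] X} (hR : IsBoundedInverse J R) (u v : X) :
    inner ℂ (R u) v = -inner ℂ u (R v) := by
  obtain ⟨hu, eu⟩ := hR.1 u
  obtain ⟨hv, ev⟩ := hR.1 v
  have := hJ ⟨R u, hu⟩ ⟨R v, hv⟩
  rw [eu, ev] at this
  exact (neg_eq_iff_eq_neg.1 this.symm)

omit [CompleteSpace X] in
theorem IsBoundedInverse.injective {A : X →ₗ.[ℂ] X} {R : X →L[ℂ] X} (hR : IsBoundedInverse A R) :
    Function.Injective R := by
  intro u v huv
  obtain ⟨hu, eu⟩ := hR.1 u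
  obtain ⟨hv, ev⟩ := hR.1 v
  rw [← eu, ← ev]
  congr 1
  exact Subtype.ext huv

-- Applying the inverse of J to J L w leaves L w, so the identity is the symmetry of L.
omit [CompleteSpace X] in
theorem inner_boundedInverse_mulOp {J L : X →ₗ.[ℂ] X} (hL : IsSymmetricOp L) {R : X →L[ℂ] X}
    (hR : IsBoundedInverse J R) (u v : (mulOp J L).domain) :
    inner ℂ (R (mulOp J L u)) (v : X) = inner ℂ (u : X) (R (mulOp J L v)) := by
  have h : ∀ w : (mulOp J L).domain, R (mulOp J L w) = L ⟨w, w.2.choose⟩ := fun w => hR.2 _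
  rw [h, h]
  exact hL ⟨u, u.2.choose⟩ ⟨v, v.2.choose⟩

end KreinCont

theorem theorem6p1 {X : Type*} [NormedAddCommGroup X] [InnerProductSpace ℂ X] [CompleteSpace X]
    (J : X →ₗ.[ℂ] X) (hJ : KreinCont.IsSkewSymmetricOp J)
    (Jinv : X →L[ℂ] X) (hJinv : KreinCont.IsBoundedInverse J Jinv)
    (I : Set ℝ) (hI : I.OrdConnected)
    (L : ℝ → X →ₗ.[ℂ] X) (hL : ∀ s ∈ I, KreinCont.IsSymmetricOp (L s))
    (hcont : KreinCont.ResolventContinuousOn (fun s => KreinCont.mulOp J (L s)) I)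
    (I' : Set ℝ) (hI' : I'.OrdConnected) (hI'I : I' ⊆ I)
    (Sig : ℝ → Finset ℂ) (P : ℝ → X →L[ℂ] X)
    (hsys : KreinCont.IsFiniteEigenvalueSystem (fun s => KreinCont.mulOp J (L s)) I' Sig P)
    (s₀ : ℝ) (hs₀ : s₀ ∈ I') :
    (KreinCont.PosDefOn Jinv (KreinCont.spectralSubspace (P s₀)) →
      (∀ s ∈ I', KreinCont.PosDefOn Jinv (KreinCont.spectralSubspace (P s))) ∧
        ∀ s ∈ I', ∀ z ∈ Sig s, z.re = 0) ∧
    (KreinCont.NegDefOn Jinv (KreinCont.spectralSubspace (P s₀)) →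
      (∀ s ∈ I', KreinCont.NegDefOn Jinv (KreinCont.spectralSubspace (P s))) ∧
        ∀ s ∈ I', ∀ z ∈ Sig s, z.re = 0) := by
  have hK := hJ.inner_boundedInverse hJinv
  have hT := fun s (hs : s ∈ I') => KreinCont.inner_boundedInverse_mulOp (hL s (hI'I hs)) hJinv
  constructor
  · intro h₀
    have hpos := fun s (hs : s ∈ I') => KreinCont.posDefOn_spectralSubspace hcont hI' hI'I hsys hK
      hJinv.injective hT hs₀ h₀ hs
    exact ⟨hpos, fun s hs z hz => hsys.re_eq_zero hs hK (hT s hs) (hpos s hs) hz⟩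
  · intro h₀
    -- The propagation argument uses only injectivity and two sign-invariant identities, so it
    -- applies to `-Jinv` with the same T(s).
    have hK' : ∀ u v, inner ℂ ((-Jinv) u) v = -inner ℂ u ((-Jinv) v) := fun u v => by
      rw [neg_apply, neg_apply, inner_neg_left, inner_neg_right, hK]
    have hT' : ∀ s ∈ I', ∀ u v : (KreinCont.mulOp J (L s)).domain,
        inner ℂ ((-Jinv) (KreinCont.mulOp J (L s) u)) (v : X) =
          inner ℂ (u : X) ((-Jinv) (KreinCont.mulOp J (L s) v)) := fun s hs u v => by
      rw [neg_apply, neg_apply, inner_neg_left, inner_neg_right, hT s hs]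
    have hinj : Function.Injective (-Jinv) := fun u v h => hJinv.injective (neg_injective h)
    simp only [KreinCont.negDefOn_iff] at h₀ ⊢
    have hpos := fun s (hs : s ∈ I') => KreinCont.posDefOn_spectralSubspace hcont hI' hI'I hsys hK'
      hinj hT' hs₀ h₀ hs
    exact ⟨hpos, fun s hs z hz => hsys.re_eq_zero hs hK' (hT' s hs) (hpos s hs) hz⟩
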